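/- Let $F$ be Thompson's group: the group, under composition, of all piecewise linear homeomorphisms of $[0,1]$ that are differentiable except at finitely many dyadic rationals and whose derivatives, where they exist, are integral powers of $2$. Let $x_0\in F$ be the element with $x_0(t)=2t$ on $[0,\tfrac14]$, $x_0(t)=t+\tfrac14$ on $[\tfrac14,\tfrac12]$, $x_0(t)=\tfrac{t+1}{2}$ on $[\tfrac12,1]$. Let $x_1\in F$ be the identity on $[0,\tfrac12]$, with $x_1(t)=\tfrac12+\tfrac12x_0(2t-1)$ on $[\tfrac12,1]$. Let $\sigma$ be the automorphism of $F$ given by $\sigma(f)(t)=1-f(1-t)$. A planar binary rooted tree with $n$ leaves determines a subdivision of $[0,1]$ into $n$ standard dyadic intervals, one for each leaf, from left to right. A pair $(T_+,T_-)$ of such trees with the same number $n$ of leaves represents $f\in F$ if $f$ maps the $i$-th interval of $T_+$ affinely onto the $i$-th interval of $T_-$ for every $i$. Every $f\in F$ is represented by such a pair. Draw $T_+$ with its root on the line $y=1$ and its leaves on the $x$-axis, and draw $T_-$ upside down below it, with the same leaves and its root on $y=-1$ (each root being joined by an edge to the topmost, respectively lowest, branching vertex or, if $n=1$, to the leaf).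 This tree diagram divides the strip $-1\le y\le 1$ into $n+1$ regions. The element $f$ is called $3$-colorable if the regions of the strip of a tree diagram representing $f$ can be colored with three colors so that any two regions sharing an edge have different colors; this does not depend on the choice of the diagram. The $3$-colorable elements form a subgroup $\mathcal F$ of $F$, the $3$-colorable subgroup. Put $$M_0=\langle \mathcal F, x_0^2\rangle,\qquad M_1=\langle \mathcal F, x_1^2\rangle,\qquad M_2=\langle \mathcal F,\sigma(x_1)^2\rangle .$$ **Theorem.** The subgroup $\mathcal F$ has infinite index in each of $M_0$, $M_1$ and $M_2$. -/

import Mathlib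

namespace Thompson

open unitInterval

/-! ### Thompson's group `F` -/

/-- Dyadic rationals. -/
def IsDyadic (x : ℝ) : Prop := ∃ (m : ℤ) (k : ℕ), x = m / 2 ^ k

/-- `f` is piecewise linear with finitely many break points, all of them dyadic rationals, and
with slopes integral powers of `2`: off a finite set `S` of dyadic rationals, `f` is affine with
slope some `2 ^ n` on every interval whose interior misses `S`. -/
def IsDyadicPL (f : I ≃ₜ I) : Prop :=
  ∃ S : Finset I, (∀ d ∈ S, IsDyadic d) ∧
    ∀ a b : I, a < b → (∀ d ∈ S, d ∉ Set.Ioo a b) →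
      ∃ n : ℤ, ∀ x ∈ Set.Icc a b, (f x : ℝ) = f a + 2 ^ n * ((x : ℝ) - a)

theorem IsDyadic.add {x y : ℝ} (hx : IsDyadic x) (hy : IsDyadic y) : IsDyadic (x + y) := by
  obtain ⟨m, k, rfl⟩ := hx
  obtain ⟨m', k', rfl⟩ := hy
  refine ⟨m * 2 ^ k' + m' * 2 ^ k, k + k', ?_⟩
  push_cast
  field_simp
  rw [pow_add]
  field_simp

theorem IsDyadic.neg {x : ℝ} (hx : IsDyadic x) : IsDyadic (-x) := by
  obtain ⟨m, k, rfl⟩ := hx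
  exact ⟨-m, k, by push_cast; ring⟩

theorem IsDyadic.zpow_mul {x : ℝ} (hx : IsDyadic x) (n : ℤ) : IsDyadic (2 ^ n * x) := by
  obtain ⟨m, k, rfl⟩ := hx
  obtain ⟨j, rfl | rfl⟩ := n.eq_nat_or_neg
  · exact ⟨m * 2 ^ j, k, by push_cast; rw [zpow_natCast]; ring⟩
  · refine ⟨m, k + j, ?_⟩
    rw [zpow_neg, zpow_natCast, pow_add]
    field_simp

theorem isDyadic_zero : IsDyadic 0 := ⟨0, 0, by simp⟩

theorem isDyadic_one : IsDyadic 1 := ⟨1, 0, by simp⟩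

theorem IsDyadicPL.strictMono {f : I ≃ₜ I} (hf : IsDyadicPL f) : StrictMono f := by
  obtain ⟨S, -, hS⟩ := hf
  rcases f.continuous.strictMono_of_inj_boundedOrder' f.injective with h | h
  · exact h
  · exfalso
    have hne : (insert (1 : I) (S.filter (0 < ·))).Nonempty := ⟨1, by simp⟩
    set b := (insert (1 : I) (S.filter (0 < ·))).min' hne with hb
    have hb0 : (0 : I) < b := by
      rw [hb, Finset.lt_min'_iff]
      intro y hy
      rcases Finset.mem_insert.1 hy with rfl | hy
      · exact zero_lt_one
      · exact (Finset.mem_filter.1 hy).2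
    obtain ⟨n, hn⟩ := hS 0 b hb0 (by
      intro d hd hd'
      have : b ≤ d := Finset.min'_le _ _
        (Finset.mem_insert_of_mem (Finset.mem_filter.2 ⟨hd, hd'.1⟩))
      exact absurd hd'.2 (not_lt.2 this))
    have h1 := hn b ⟨hb0.le, le_rfl⟩
    have h2 : (f b : ℝ) < f 0 := h hb0
    have h3 : (0 : ℝ) < b := hb0
    have h4 : (0 : ℝ) < 2 ^ n * ((b : ℝ) - (0 : I)) := by
      have : ((0 : I) : ℝ) = 0 := rfl
      rw [this, sub_zero]
      positivity
    linarith

theorem map_zero_of_strictMono {f : I ≃ₜ I} (hf : StrictMono f) : f 0 = 0 := by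
  refine le_antisymm ?_ nonneg'
  have := hf.monotone (show (0 : I) ≤ f.symm 0 from nonneg')
  simpa using this

theorem IsDyadicPL.isDyadic_apply {f : I ≃ₜ I} (hf : IsDyadicPL f) (t : I)
    (ht : IsDyadic t) : IsDyadic (f t) := by
  have hmono := hf.strictMono
  obtain ⟨S, hSd, hS⟩ := hf
  have h0 : f 0 = 0 := map_zero_of_strictMono hmono
  induction hk : (S.filter (· < t)).card using Nat.strong_induction_on generalizing t with
  | _ k ih =>
    rcases (nonneg' : (0 : I) ≤ t).eq_or_lt with rfl | htpos
    · rw [h0]; exact isDyadic_zero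
    by_cases hne : (S.filter (· < t)).Nonempty
    · set s := (S.filter (· < t)).max' hne with hs
      have hsm := Finset.mem_filter.1 (Finset.max'_mem _ hne)
      rw [← hs] at hsm
      have hfs : IsDyadic (f s) := by
        refine ih _ ?_ s (hSd s hsm.1) rfl
        rw [← hk]
        refine Finset.card_lt_card ⟨?_, ?_⟩
        · intro d hd
          have := Finset.mem_filter.1 hd
          exact Finset.mem_filter.2 ⟨this.1, this.2.trans hsm.2⟩
        · intro h
          have := h (Finset.max'_mem _ hne)
          rw [← hs] at this
          exact lt_irrefl _ (Finset.mem_filter.1 this).2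
      obtain ⟨n, hn⟩ := hS s t hsm.2 (by
        intro d hd hd'
        have : d ≤ s := Finset.le_max' _ _ (Finset.mem_filter.2 ⟨hd, hd'.2⟩)
        exact absurd hd'.1 (not_lt.2 this))
      rw [hn t ⟨hsm.2.le, le_rfl⟩]
      refine hfs.add (IsDyadic.zpow_mul ?_ n)
      rw [sub_eq_add_neg]
      exact ht.add (hSd s hsm.1).neg
    · obtain ⟨n, hn⟩ := hS 0 t htpos (by
        intro d hd hd'
        exact hne ⟨d, Finset.mem_filter.2 ⟨hd, hd'.2⟩⟩)
      rw [hn t ⟨htpos.le, le_rfl⟩, h0]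
      refine isDyadic_zero.add (IsDyadic.zpow_mul ?_ n)
      rw [sub_eq_add_neg]
      exact ht.add isDyadic_zero.neg

theorem IsDyadicPL.one : IsDyadicPL 1 :=
  ⟨∅, by simp, fun a b _ _ => ⟨0, fun x _ => by simp⟩⟩

theorem IsDyadicPL.inv {f : I ≃ₜ I} (hf : IsDyadicPL f) : IsDyadicPL f⁻¹ := by
  have hmono := hf.strictMono
  have hdy := hf.isDyadic_apply
  obtain ⟨S, hSd, hS⟩ := hf
  have hinv : StrictMono f.symm := by
    intro x y hxy
    rw [← hmono.lt_iff_lt]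
    simpa using hxy
  refine ⟨S.image f, ?_, ?_⟩
  · intro d hd
    obtain ⟨e, he, rfl⟩ := Finset.mem_image.1 hd
    exact hdy e (hSd e he)
  · intro a b hab h
    obtain ⟨n, hn⟩ := hS (f.symm a) (f.symm b) (hinv hab) (by
      intro d hd hd'
      refine h (f d) (Finset.mem_image_of_mem _ hd) ⟨?_, ?_⟩
      · have := hmono hd'.1
        simpa using this
      · have := hmono hd'.2
        simpa using this)
    refine ⟨-n, fun x hx => ?_⟩
    have := hn (f.symm x) ⟨hinv.monotone hx.1, hinv.monotone hx.2⟩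
    simp only [Homeomorph.apply_symm_apply] at this
    change (f.symm x : ℝ) = f.symm a + 2 ^ (-n) * ((x : ℝ) - a)
    rw [this, zpow_neg]
    field_simp
    ring

theorem IsDyadicPL.mul {f g : I ≃ₜ I} (hf : IsDyadicPL f) (hg : IsDyadicPL g) :
    IsDyadicPL (f * g) := by
  have hmono := hg.strictMono
  have hdy := hg.inv.isDyadic_apply
  obtain ⟨S, hSd, hS⟩ := hf
  obtain ⟨S', hSd', hS'⟩ := hg
  refine ⟨S' ∪ S.image (g⁻¹ : I ≃ₜ I), ?_, ?_⟩
  · intro d hd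
    rcases Finset.mem_union.1 hd with hd | hd
    · exact hSd' d hd
    · obtain ⟨e, he, rfl⟩ := Finset.mem_image.1 hd
      exact hdy e (hSd e he)
  · intro a b hab h
    obtain ⟨n, hn⟩ := hS' a b hab fun d hd => h d (Finset.mem_union_left _ hd)
    obtain ⟨m, hm⟩ := hS (g a) (g b) (hmono hab) (by
      intro d hd hd'
      have key : g ((g⁻¹ : I ≃ₜ I) d) = d := g.apply_symm_apply d
      refine h ((g⁻¹ : I ≃ₜ I) d)
        (Finset.mem_union_right _ (Finset.mem_image_of_mem _ hd)) ⟨?_, ?_⟩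
      · rw [← hmono.lt_iff_lt, key]; exact hd'.1
      · rw [← hmono.lt_iff_lt, key]; exact hd'.2)
    refine ⟨m + n, fun x hx => ?_⟩
    change (f (g x) : ℝ) = f (g a) + 2 ^ (m + n) * ((x : ℝ) - a)
    rw [hm (g x) ⟨hmono.monotone hx.1, hmono.monotone hx.2⟩, hn x hx,
      zpow_add₀ (by norm_num)]
    ring

/-- Thompson's group `F`, with composition of homeomorphisms `(f * g) t = f (g t)` as product. -/
def F : Subgroup (I ≃ₜ I) where
  carrier := {f | IsDyadicPL f}
  mul_mem' hf hg := hf.mul hg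
  one_mem' := IsDyadicPL.one
  inv_mem' hf := hf.inv

/-- Reflection of the interval: `(reflect f) t = 1 - f (1 - t)`. -/
def reflect (f : I ≃ₜ I) : I ≃ₜ I := symmHomeomorph * f * symmHomeomorph

theorem reflect_apply (f : I ≃ₜ I) (t : I) : reflect f t = σ (f (σ t)) := rfl

theorem IsDyadicPL.reflect {f : I ≃ₜ I} (hf : IsDyadicPL f) : IsDyadicPL (reflect f) := by
  obtain ⟨S, hSd, hS⟩ := hf
  refine ⟨S.image σ, ?_, ?_⟩
  · intro d hd
    obtain ⟨e, he, rfl⟩ := Finset.mem_image.1 hd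
    rw [coe_symm_eq, sub_eq_add_neg]
    exact isDyadic_one.add (hSd e he).neg
  · intro a b hab h
    obtain ⟨n, hn⟩ := hS (σ b) (σ a) (strictAnti_symm hab) (by
      intro d hd hd'
      refine h (σ d) (Finset.mem_image_of_mem _ hd) ⟨?_, ?_⟩
      · have := strictAnti_symm hd'.2
        simpa using this
      · have := strictAnti_symm hd'.1
        simpa using this)
    refine ⟨n, fun x hx => ?_⟩
    have h1 := hn (σ x) ⟨strictAnti_symm.antitone hx.2, strictAnti_symm.antitone hx.1⟩
    have h2 := hn (σ a) ⟨(strictAnti_symm hab).le, le_rfl⟩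
    rw [reflect_apply, reflect_apply, coe_symm_eq, coe_symm_eq, h1, h2]
    simp only [coe_symm_eq]
    ring

/-- The order two automorphism `σ` of `F` that reflects tree diagrams about a vertical line. -/
def sigma : F ≃* F where
  toFun f := ⟨reflect f, IsDyadicPL.reflect f.2⟩
  invFun f := ⟨reflect f, IsDyadicPL.reflect f.2⟩
  left_inv f := by ext t; simp [reflect_apply]
  right_inv f := by ext t; simp [reflect_apply]
  map_mul' f g := by ext t; simp [reflect_apply]

/-- The homeomorphism with slopes `2`, `1`, `1/2` on `[0, 1/4]`, `[1/4, 1/2]`, `[1/2, 1]`. -/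
noncomputable def x₀Homeo : I ≃ₜ I where
  toFun t := ⟨min (2 * t) (min (t + 1 / 4) ((t + 1) / 2)), by
    have h0 := t.2.1
    have h1 := t.2.2
    refine ⟨by simp only [le_min_iff]; refine ⟨?_, ?_, ?_⟩ <;> linarith, ?_⟩
    exact (min_le_right _ _).trans ((min_le_right _ _).trans (by linarith))⟩
  invFun t := ⟨max (t / 2) (max (t - 1 / 4) (2 * t - 1)), by
    have h0 := t.2.1
    have h1 := t.2.2
    refine ⟨le_max_of_le_left (by linarith), ?_⟩
    simp only [max_le_iff]; refine ⟨?_, ?_, ?_⟩ <;> linarith⟩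
  left_inv t := by
    ext
    dsimp only
    grind
  right_inv t := by
    ext
    dsimp only
    grind
  continuous_toFun := by fun_prop
  continuous_invFun := by fun_prop

/-- The homeomorphism with slopes `1`, `2`, `1`, `1/2` on
`[0, 1/2]`, `[1/2, 5/8]`, `[5/8, 3/4]`, `[3/4, 1]`. -/
noncomputable def x₁Homeo : I ≃ₜ I where
  toFun t := ⟨max t (min (2 * t - 1 / 2) (min (t + 1 / 8) ((t + 1) / 2))), by
    have h0 := t.2.1
    have h1 := t.2.2
    refine ⟨le_max_of_le_left h0, max_le h1 ?_⟩
    exact (min_le_right _ _).trans ((min_le_right _ _).trans (by linarith))⟩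
  invFun t := ⟨min t (max (t / 2 + 1 / 4) (max (t - 1 / 8) (2 * t - 1))), by
    have h0 := t.2.1
    have h1 := t.2.2
    exact ⟨le_min h0 (le_max_of_le_left (by linarith)), (min_le_left _ _).trans h1⟩⟩
  left_inv t := by
    ext
    dsimp only
    grind
  right_inv t := by
    ext
    dsimp only
    grind
  continuous_toFun := by fun_prop
  continuous_invFun := by fun_prop

theorem x₀Homeo_apply (t : I) :
    (x₀Homeo t : ℝ) = min (2 * (t : ℝ)) (min (t + 1 / 4) ((t + 1) / 2)) := rfl

theorem x₁Homeo_apply (t : I) :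
    (x₁Homeo t : ℝ) = max (t : ℝ) (min (2 * t - 1 / 2) (min (t + 1 / 8) ((t + 1) / 2))) := rfl

theorem isDyadicPL_x₀ : IsDyadicPL x₀Homeo := by
  refine ⟨{⟨1 / 4, by norm_num, by norm_num⟩, ⟨1 / 2, by norm_num, by norm_num⟩}, ?_, ?_⟩
  · intro d hd
    simp only [Finset.mem_insert, Finset.mem_singleton] at hd
    rcases hd with rfl | rfl
    · exact ⟨1, 2, by norm_num⟩
    · exact ⟨1, 1, by norm_num⟩
  · intro a b hab h
    simp only [Finset.mem_insert, Finset.mem_singleton, forall_eq_or_imp, forall_eq, Set.mem_Ioo,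
      ← Subtype.coe_lt_coe, not_and, not_lt] at h hab
    obtain ⟨h1, h2⟩ := h
    have key : (b : ℝ) ≤ 1 / 4 ∨ ((1 / 4 : ℝ) ≤ a ∧ (b : ℝ) ≤ 1 / 2) ∨ (1 / 2 : ℝ) ≤ a := by
      grind
    rcases key with h | h | h
    · refine ⟨1, fun x hx => ?_⟩
      have h3 : (a : ℝ) ≤ x := hx.1
      have h4 : (x : ℝ) ≤ b := hx.2
      rw [x₀Homeo_apply, x₀Homeo_apply, zpow_one]
      grind
    · refine ⟨0, fun x hx => ?_⟩
      have h3 : (a : ℝ) ≤ x := hx.1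
      have h4 : (x : ℝ) ≤ b := hx.2
      rw [x₀Homeo_apply, x₀Homeo_apply, zpow_zero]
      grind
    · refine ⟨-1, fun x hx => ?_⟩
      have h3 : (a : ℝ) ≤ x := hx.1
      have h4 : (x : ℝ) ≤ b := hx.2
      rw [x₀Homeo_apply, x₀Homeo_apply, zpow_neg, zpow_one]
      grind

theorem isDyadicPL_x₁ : IsDyadicPL x₁Homeo := by
  refine ⟨{⟨1 / 2, by norm_num, by norm_num⟩, ⟨5 / 8, by norm_num, by norm_num⟩,
    ⟨3 / 4, by norm_num, by norm_num⟩}, ?_, ?_⟩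
  · intro d hd
    simp only [Finset.mem_insert, Finset.mem_singleton] at hd
    rcases hd with rfl | rfl | rfl
    · exact ⟨1, 1, by norm_num⟩
    · exact ⟨5, 3, by norm_num⟩
    · exact ⟨3, 2, by norm_num⟩
  · intro a b hab h
    simp only [Finset.mem_insert, Finset.mem_singleton, forall_eq_or_imp, forall_eq, Set.mem_Ioo,
      ← Subtype.coe_lt_coe, not_and, not_lt] at h hab
    obtain ⟨h1, h2, h3⟩ := h
    have key : (b : ℝ) ≤ 1 / 2 ∨ ((1 / 2 : ℝ) ≤ a ∧ (b : ℝ) ≤ 5 / 8) ∨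
        ((5 / 8 : ℝ) ≤ a ∧ (b : ℝ) ≤ 3 / 4) ∨ (3 / 4 : ℝ) ≤ a := by
      grind
    have h1 := b.2.2
    rcases key with h | h | h | h
    · refine ⟨0, fun x hx => ?_⟩
      have h3 : (a : ℝ) ≤ x := hx.1
      have h4 : (x : ℝ) ≤ b := hx.2
      rw [x₁Homeo_apply, x₁Homeo_apply, zpow_zero]
      grind
    · refine ⟨1, fun x hx => ?_⟩
      have h3 : (a : ℝ) ≤ x := hx.1
      have h4 : (x : ℝ) ≤ b := hx.2
      rw [x₁Homeo_apply, x₁Homeo_apply, zpow_one]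
      grind
    · refine ⟨0, fun x hx => ?_⟩
      have h3 : (a : ℝ) ≤ x := hx.1
      have h4 : (x : ℝ) ≤ b := hx.2
      rw [x₁Homeo_apply, x₁Homeo_apply, zpow_zero]
      grind
    · refine ⟨-1, fun x hx => ?_⟩
      have h3 : (a : ℝ) ≤ x := hx.1
      have h4 : (x : ℝ) ≤ b := hx.2
      rw [x₁Homeo_apply, x₁Homeo_apply, zpow_neg, zpow_one]
      grind

/-- The standard generator `x₀` of `F`. -/
noncomputable def x₀ : F := ⟨x₀Homeo, isDyadicPL_x₀⟩

/-- The standard generator `x₁` of `F`, which is `x₀` squeezed onto `[1/2, 1]`. -/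
noncomputable def x₁ : F := ⟨x₁Homeo, isDyadicPL_x₁⟩

/-! ### Tree diagrams and the 3-colorable subgroup -/

/-- The leaves of a planar binary rooted tree, from left to right; a leaf is given by the path
leading to it from the root (`false` is a left edge, `true` is a right edge). -/
def leaves : BinaryTree Unit → List (List Bool)
  | .nil => [[]]
  | .node _ l r => (leaves l).map (List.cons false) ++ (leaves r).map (List.cons true)

/-- The affine map of `[0, 1]` onto its left or right half. -/
noncomputable def half (b : Bool) (s : I) : I :=
  ⟨((if b then 1 else 0) + (s : ℝ)) / 2, by
    have h0 := s.2.1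
    have h1 := s.2.2
    constructor <;> split_ifs <;> linarith⟩

/-- The increasing affine map of `[0, 1]` onto the standard dyadic interval
`[.w, .w + 2 ^ (-|w|)]` of points with a binary expansion starting with `w`. -/
noncomputable def cone : List Bool → I → I
  | [], s => s
  | b :: w, s => half b (cone w s)

/-- The tree diagram with top tree `T` and bottom tree `S` (with equally many leaves) represents
`f`: the map `f` sends the standard dyadic interval of the `i`-th leaf of `T` affinely onto
that of the `i`-th leaf of `S`, for all `i`. -/
def Represents (T S : BinaryTree Unit) (f : I ≃ₜ I) : Prop :=
  List.Forall₂ (fun v w => ∀ s : I, f (cone v s) = cone w s) (leaves T) (leaves S)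

/-- Draw a tree with `n` leaves in a half-strip, with its leaves at the points `k, …, k + n - 1`
of the `x`-axis. Every region of the half-strip meets the `x`-axis in exactly one of the `n + 1`
gaps around the leaves, gap `j` being between `j - 1` and `j`. Every vertex `v` has an edge above
it (going up to its parent, or to the boundary of the strip for the root); if the leaves below
`v` are `a, …, b - 1`, this edge has region `a` on its left and region `b` on its right.
`EdgeBetween T k a b` says that some edge of `T` separates the regions `a` and `b` in this way. -/
def EdgeBetween : BinaryTree Unit → ℕ → ℕ → ℕ → Prop
  | .nil, k, a, b => a = k ∧ b = k + 1
  | .node _ l r, k, a, b => (a = k ∧ b = k + (l.numLeaves + r.numLeaves)) ∨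
      EdgeBetween l k a b ∨ EdgeBetween r (k + l.numLeaves) a b

/-- The adjacency graph of the regions of the strip of the tree diagram `(T, S)`, where `T` and
`S` have the same number `n` of leaves: there are `n + 1` regions, one for each gap around the
leaves on the `x`-axis, and two regions are adjacent if they share an edge of `T` or of `S`. -/
def stripGraph (T S : BinaryTree Unit) : SimpleGraph (Fin (T.numLeaves + 1)) :=
  SimpleGraph.fromRel fun i j => EdgeBetween T 0 i j ∨ EdgeBetween S 0 i j

/-- `f` is represented by a tree diagram whose strip is 3-colorable. (Inserting or cancelling a
pair of opposing carets does not affect 3-colorability of the strip, so one may as well take the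
reduced tree diagram of `f`.) -/
def IsThreeColorable (f : I ≃ₜ I) : Prop :=
  ∃ T S : BinaryTree Unit, Represents T S f ∧ (stripGraph T S).Colorable 3

/-! The rest of this part shows that the 3-colorable elements form a subgroup. -/

theorem length_leaves (T : BinaryTree Unit) : (leaves T).length = T.numLeaves := by
  induction T with
  | nil => rfl
  | node u l r ihl ihr => simp [leaves, ihl, ihr]

theorem cone_append (v w : List Bool) (s : I) : cone (v ++ w) s = cone v (cone w s) := by
  induction v with
  | nil => rfl
  | cons b v ih => simp [cone, ih]

/-- The colors of the regions to the left and right of a vertex in the infinite binary tree, when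
the regions to the left and right of the root have colors `x` and `y`. -/
def colors : ZMod 3 → ZMod 3 → List Bool → ZMod 3 × ZMod 3
  | x, y, [] => (x, y)
  | x, y, false :: w => colors x (-(x + y)) w
  | x, y, true :: w => colors (-(x + y)) y w

theorem colors_append (x y : ZMod 3) (v w : List Bool) :
    colors x y (v ++ w) = colors (colors x y v).1 (colors x y v).2 w := by
  induction v generalizing x y with
  | nil => rfl
  | cons b v ih => cases b <;> simp [colors, ih]

theorem third_eq : ∀ x y z : ZMod 3, x ≠ y → x ≠ z → z ≠ y → z = -(x + y) := by decide

theorem third_ne : ∀ x y : ZMod 3, x ≠ y → x ≠ -(x + y) ∧ -(x + y) ≠ y := by decide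

theorem third_affine : ∀ x y p q : ZMod 3,
    (q - p) * (-(x + y)) + p = -(((q - p) * x + p) + ((q - p) * y + p)) := by decide

theorem affine_normalize : ∀ x y : ZMod 3, x ≠ y → ∃ p q : ZMod 3,
    (q - p) * x + p = 0 ∧ (q - p) * y + p = 1 := by decide

theorem colors_affine (p q x y : ZMod 3) (w : List Bool) :
    colors ((q - p) * x + p) ((q - p) * y + p) w =
      ((q - p) * (colors x y w).1 + p, (q - p) * (colors x y w).2 + p) := by
  induction w generalizing x y with
  | nil => rfl
  | cons b w ih => cases b <;> simp only [colors] <;> rw [← third_affine, ih]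

theorem EdgeBetween.bounds {T : BinaryTree Unit} {k a b : ℕ} (h : EdgeBetween T k a b) :
    k ≤ a ∧ a < b ∧ b ≤ k + T.numLeaves := by
  induction T generalizing k with
  | nil => simp only [EdgeBetween] at h; simp only [BinaryTree.numLeaves]; omega
  | node u l r ihl ihr =>
    have hl : 0 < l.numLeaves := by rw [BinaryTree.numLeaves_eq_numNodes_succ]; omega
    simp only [BinaryTree.numLeaves]
    rcases h with h | h | h
    · omega
    · have := ihl h; omega
    · have := ihr h; omega

theorem edgeBetween_root (T : BinaryTree Unit) (k : ℕ) :
    EdgeBetween T k k (k + T.numLeaves) := by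
  cases T with
  | nil => exact ⟨rfl, rfl⟩
  | node u l r => exact Or.inl ⟨rfl, rfl⟩

theorem map_colors_of_proper (c : ℕ → ZMod 3) (T : BinaryTree Unit) (k : ℕ)
    (hc : ∀ a b, EdgeBetween T k a b → c a ≠ c b) :
    (leaves T).map (colors (c k) (c (k + T.numLeaves))) =
      (List.range' k T.numLeaves).map fun i => (c i, c (i + 1)) := by
  induction T generalizing k with
  | nil => simp [leaves, colors]
  | node u l r ihl ihr =>
    have h1 := ihl k fun a b h => hc a b (Or.inr (Or.inl h))
    have h2 := ihr (k + l.numLeaves) fun a b h => hc a b (Or.inr (Or.inr h))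
    have h3 : c (k + l.numLeaves) = -(c k + c (k + (l.numLeaves + r.numLeaves))) := by
      refine third_eq _ _ _ (hc _ _ (Or.inl ⟨rfl, rfl⟩))
        (hc _ _ (Or.inr (Or.inl (edgeBetween_root l k)))) ?_
      have := edgeBetween_root r (k + l.numLeaves)
      rw [add_assoc] at this
      exact hc _ _ (Or.inr (Or.inr this))
    rw [add_assoc] at h2
    rw [h3] at h1 h2
    simp only [BinaryTree.numLeaves, leaves, List.map_append, List.map_map]
    rw [← List.range'_append_1, List.map_append, ← h1, ← h2]
    rfl

theorem proper_of_map_colors (c : ℕ → ZMod 3) (T : BinaryTree Unit) (k : ℕ) (x y : ZMod 3)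
    (hxy : x ≠ y) (hc : (List.range' k T.numLeaves).map c =
      (leaves T).map fun w => (colors x y w).1) (hy : c (k + T.numLeaves) = y) :
    c k = x ∧ ∀ a b, EdgeBetween T k a b → c a ≠ c b := by
  induction T generalizing k x y with
  | nil =>
    simp only [BinaryTree.numLeaves, leaves, List.range'_one, List.map_cons, List.map_nil,
      List.cons.injEq, and_true, colors] at hc hy
    refine ⟨hc, ?_⟩
    rintro a b ⟨rfl, rfl⟩
    rw [hc, hy]
    exact hxy
  | node u l r ihl ihr =>
    simp only [BinaryTree.numLeaves, leaves, List.map_append, List.map_map] at hc hy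
    rw [← List.range'_append_1, List.map_append] at hc
    obtain ⟨hc1, hc2⟩ := List.append_inj hc (by simp [length_leaves])
    obtain ⟨hr1, hr2⟩ := ihr (k + l.numLeaves) (-(x + y)) y (third_ne x y hxy).2 hc2
      (by rw [add_assoc]; exact hy)
    obtain ⟨hl1, hl2⟩ := ihl k x (-(x + y)) (third_ne x y hxy).1 hc1 hr1
    refine ⟨hl1, ?_⟩
    rintro a b (⟨rfl, rfl⟩ | h | h)
    · rw [hl1, hy]; exact hxy
    · exact hl2 a b h
    · exact hr2 a b h

/-- Two vertices of the infinite binary tree are surrounded by the same colors. -/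
def SameColors (v w : List Bool) : Prop := colors 0 1 v = colors 0 1 w

/-- The strip of a tree diagram is 3-colorable exactly when the two trees induce the same colors
at the leaves. -/
theorem colorable_iff (T S : BinaryTree Unit) (h : T.numLeaves = S.numLeaves) :
    (stripGraph T S).Colorable 3 ↔ List.Forall₂ SameColors (leaves T) (leaves S) := by
  have hmap : List.Forall₂ SameColors (leaves T) (leaves S) ↔
      (leaves T).map (colors 0 1) = (leaves S).map (colors 0 1) := by
    rw [← List.forall₂_eq_eq_eq, List.forall₂_map_left_iff, List.forall₂_map_right_iff]
    rfl
  rw [hmap]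
  constructor
  · rintro ⟨C⟩
    let C' : Fin (T.numLeaves + 1) → ZMod 3 := C
    have hC : ∀ i j, (stripGraph T S).Adj i j → C' i ≠ C' j := fun i j hij => C.valid hij
    let c : ℕ → ZMod 3 := fun i => if h : i < T.numLeaves + 1 then C' ⟨i, h⟩ else 0
    have hc : ∀ a b, EdgeBetween T 0 a b ∨ EdgeBetween S 0 a b → c a ≠ c b := by
      intro a b hab
      have hb : a < b ∧ b < T.numLeaves + 1 := by
        rcases hab with hab | hab <;> have := hab.bounds <;> omega
      have ha : a < T.numLeaves + 1 := by omega
      simp only [c, ha, hb.2, dif_pos]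
      refine hC _ _ ⟨?_, Or.inl hab⟩
      simp only [ne_eq, Fin.mk.injEq]
      omega
    have h1 := map_colors_of_proper c T 0 fun a b hab => hc a b (Or.inl hab)
    have h2 := map_colors_of_proper c S 0 fun a b hab => hc a b (Or.inr hab)
    rw [← h, ← h1] at h2
    obtain ⟨p, q, hp, hq⟩ := affine_normalize (c 0) (c (0 + T.numLeaves))
      (hc _ _ (Or.inl (edgeBetween_root T 0)))
    have h3 := congrArg (List.map fun z : ZMod 3 × ZMod 3 =>
      ((q - p) * z.1 + p, (q - p) * z.2 + p)) h2
    rw [List.map_map, List.map_map] at h3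
    have h4 : (fun z : ZMod 3 × ZMod 3 => ((q - p) * z.1 + p, (q - p) * z.2 + p)) ∘
        colors (c 0) (c (0 + T.numLeaves)) = colors 0 1 := by
      funext w
      have := colors_affine p q (c 0) (c (0 + T.numLeaves)) w
      rw [hp, hq] at this
      exact this.symm
    rw [h4] at h3
    exact h3.symm
  · intro hTS
    have hlen := length_leaves T
    let c : ℕ → ZMod 3 := fun i => ((leaves T).map fun w => (colors 0 1 w).1).getD i 1
    have hc1 : (List.range' 0 T.numLeaves).map c =
        (leaves T).map fun w => (colors 0 1 w).1 := by
      refine List.ext_getElem (by simp [hlen]) fun i h1 h2 => ?_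
      simp only [List.length_map] at h2
      simp [c, h2]
    have hc2 : (List.range' 0 S.numLeaves).map c =
        (leaves S).map fun w => (colors 0 1 w).1 := by
      rw [← h, hc1]
      have := congrArg (List.map Prod.fst) hTS
      simpa [List.map_map, Function.comp_def] using this
    have hcn : c (0 + T.numLeaves) = 1 := by simp [c, hlen]
    have h1 := (proper_of_map_colors c T 0 0 1 (by decide) hc1 hcn).2
    have h2 := (proper_of_map_colors c S 0 0 1 (by decide) hc2 (by rw [← h]; exact hcn)).2
    refine ⟨SimpleGraph.Coloring.mk (fun i => (c i : Fin 3)) ?_⟩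
    rintro i j ⟨-, (hij | hij) | (hij | hij)⟩
    · exact h1 _ _ hij
    · exact h2 _ _ hij
    · exact (h1 _ _ hij).symm
    · exact (h2 _ _ hij).symm

/-- `f` maps the interval of `v` affinely onto that of `w`, and `v`, `w` have the same colors. -/
def Matches (f : I ≃ₜ I) (v w : List Bool) : Prop :=
  (∀ s : I, f (cone v s) = cone w s) ∧ SameColors v w

theorem isThreeColorable_iff (f : I ≃ₜ I) : IsThreeColorable f ↔
    ∃ T S : BinaryTree Unit, List.Forall₂ (Matches f) (leaves T) (leaves S) := by
  constructor
  · rintro ⟨T, S, h1, h2⟩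
    have hlen : T.numLeaves = S.numLeaves := by
      rw [← length_leaves, ← length_leaves]; exact h1.length_eq
    rw [colorable_iff T S hlen] at h2
    refine ⟨T, S, List.forall₂_iff_get.2 ⟨h1.length_eq, fun i hi hi' => ⟨?_, ?_⟩⟩⟩
    · exact (List.forall₂_iff_get.1 h1).2 i hi hi'
    · exact (List.forall₂_iff_get.1 h2).2 i hi hi'
  · rintro ⟨T, S, h⟩
    refine ⟨T, S, h.imp fun _ _ h => h.1, ?_⟩
    rw [colorable_iff]
    · exact h.imp fun _ _ h => h.2
    · rw [← length_leaves, ← length_leaves]; exact h.length_eq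

theorem Matches.append {f : I ≃ₜ I} {v w : List Bool} (h : Matches f v w) (u : List Bool) :
    Matches f (v ++ u) (w ++ u) := by
  refine ⟨fun s => ?_, ?_⟩
  · rw [cone_append, cone_append, h.1]
  · have := h.2
    simp only [SameColors, colors_append] at this ⊢
    rw [this]

theorem Matches.symm {f : I ≃ₜ I} {v w : List Bool} (h : Matches f v w) :
    Matches f⁻¹ w v := by
  refine ⟨fun s => ?_, Eq.symm h.2⟩
  rw [← h.1]
  exact f.symm_apply_apply _

theorem Matches.trans {f g : I ≃ₜ I} {u v w : List Bool} (h : Matches g u v)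
    (h' : Matches f v w) : Matches (f * g) u w := by
  refine ⟨fun s => ?_, Eq.trans h.2 h'.2⟩
  rw [← h'.1, ← h.1]
  rfl

/-- `T'` is obtained from `T` by attaching a caret at a leaf. -/
def Grow (T T' : BinaryTree Unit) : Prop :=
  ∃ (A B : List (List Bool)) (w : List Bool), leaves T = A ++ w :: B ∧
    leaves T' = A ++ (w ++ [false]) :: (w ++ [true]) :: B

theorem exists_grow (T : BinaryTree Unit) (A B : List (List Bool)) (w : List Bool)
    (h : leaves T = A ++ w :: B) :
    ∃ T', leaves T' = A ++ (w ++ [false]) :: (w ++ [true]) :: B := by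
  induction T generalizing A B w with
  | nil =>
    refine ⟨.node () .nil .nil, ?_⟩
    rw [leaves, List.singleton_eq_append_iff] at h
    rcases h with ⟨rfl, h⟩ | ⟨rfl, h⟩
    · obtain ⟨rfl, rfl⟩ := List.cons.inj h
      rfl
    · simp at h
  | node u l r ihl ihr =>
    rw [leaves, List.append_eq_append_iff] at h
    have left : ∀ A' B', (leaves l).map (List.cons false) = A' ++ w :: B' →
        ∃ T', leaves T' = A' ++ (w ++ [false]) :: (w ++ [true]) :: B' ++
          (leaves r).map (List.cons true) := by
      intro A' B' h'
      obtain ⟨A1, B1, h1, rfl, h2⟩ := List.map_eq_append_iff.1 h'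
      obtain ⟨w1, B2, rfl, rfl, rfl⟩ := List.map_eq_cons_iff.1 h2
      obtain ⟨l', hl'⟩ := ihl _ _ _ h1
      exact ⟨.node () l' r, by simp [leaves, hl']⟩
    have right : ∀ A' B', (leaves r).map (List.cons true) = A' ++ w :: B' →
        ∃ T', leaves T' = (leaves l).map (List.cons false) ++
          (A' ++ (w ++ [false]) :: (w ++ [true]) :: B') := by
      intro A' B' h'
      obtain ⟨A1, B1, h1, rfl, h2⟩ := List.map_eq_append_iff.1 h'
      obtain ⟨w1, B2, rfl, rfl, rfl⟩ := List.map_eq_cons_iff.1 h2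
      obtain ⟨r', hr'⟩ := ihr _ _ _ h1
      exact ⟨.node () l r', by simp [leaves, hr']⟩
    rcases h with ⟨C, rfl, h⟩ | ⟨C, hl, h⟩
    · obtain ⟨T', hT'⟩ := right C B h
      exact ⟨T', by rw [hT', List.append_assoc]⟩
    · cases C with
      | nil =>
        obtain ⟨T', hT'⟩ := right [] B (by simpa using h.symm)
        exact ⟨T', by rw [hT', hl]; simp⟩
      | cons w' C =>
        obtain ⟨rfl, rfl⟩ := List.cons.inj h
        obtain ⟨T', hT'⟩ := left A C hl
        exact ⟨T', by rw [hT']; simp⟩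

theorem Grow.node_left {l l' : BinaryTree Unit} (r : BinaryTree Unit) (h : Grow l l') :
    Grow (.node () l r) (.node () l' r) := by
  obtain ⟨A, B, w, h1, h2⟩ := h
  exact ⟨A.map (List.cons false), B.map (List.cons false) ++ (leaves r).map (List.cons true),
    false :: w, by simp [leaves, h1], by simp [leaves, h2]⟩

theorem Grow.node_right (l : BinaryTree Unit) {r r' : BinaryTree Unit} (h : Grow r r') :
    Grow (.node () l r) (.node () l r') := by
  obtain ⟨A, B, w, h1, h2⟩ := h
  exact ⟨(leaves l).map (List.cons false) ++ A.map (List.cons true), B.map (List.cons true),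
    true :: w, by simp [leaves, h1], by simp [leaves, h2]⟩

/-- The complete binary tree with `2 ^ n` leaves. -/
def completeTree : ℕ → BinaryTree Unit
  | 0 => .nil
  | n + 1 => .node () (completeTree n) (completeTree n)

theorem grow_node {l l' r r' : BinaryTree Unit} (hl : Relation.ReflTransGen Grow l l')
    (hr : Relation.ReflTransGen Grow r r') :
    Relation.ReflTransGen Grow (.node () l r) (.node () l' r') :=
  (hl.lift (fun t => BinaryTree.node () t r) fun _ _ h => h.node_left r).trans
    (hr.lift (fun t => BinaryTree.node () l' t) fun _ _ h => h.node_right l')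

theorem grow_complete (T : BinaryTree Unit) (n : ℕ) (h : T.height ≤ n) :
    Relation.ReflTransGen Grow T (completeTree n) := by
  induction n generalizing T with
  | zero =>
    cases T with
    | nil => exact .refl
    | node u l r => simp at h
  | succ n ih =>
    cases T with
    | nil =>
      exact (Relation.ReflTransGen.single
        (⟨[], [], [], rfl, rfl⟩ : Grow .nil (.node () .nil .nil))).trans
        (grow_node (ih .nil (by simp)) (ih .nil (by simp)))
    | node u l r =>
      simp only [BinaryTree.height, Nat.add_le_add_iff_right, max_le_iff] at h
      exact grow_node (ih l h.1) (ih r h.2)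

theorem exists_matches_of_grow {f : I ≃ₜ I} {T S S' : BinaryTree Unit}
    (h : List.Forall₂ (Matches f) (leaves T) (leaves S)) (hS : Relation.ReflTransGen Grow S S') :
    ∃ T', List.Forall₂ (Matches f) (leaves T') (leaves S') := by
  induction hS with
  | refl => exact ⟨T, h⟩
  | tail _ hg ih =>
    obtain ⟨T1, h1⟩ := ih
    obtain ⟨A, B, w, hw, hw'⟩ := hg
    rw [hw] at h1
    have hA := List.forall₂_take_append _ _ _ h1
    have hB := List.forall₂_drop_append _ _ _ h1
    obtain ⟨v, B1, hvw, hB1, hdrop⟩ := List.forall₂_cons_right_iff.1 hB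
    obtain ⟨T', hT'⟩ := exists_grow T1 ((leaves T1).take A.length) B1 v
      (by rw [← hdrop, List.take_append_drop])
    refine ⟨T', ?_⟩
    rw [hT', hw']
    exact List.rel_append hA (.cons (hvw.append _) (.cons (hvw.append _) hB1))

theorem IsThreeColorable.one : IsThreeColorable 1 := by
  rw [isThreeColorable_iff]
  exact ⟨.nil, .nil, .cons ⟨fun _ => rfl, rfl⟩ .nil⟩

theorem IsThreeColorable.inv {f : I ≃ₜ I} (hf : IsThreeColorable f) :
    IsThreeColorable f⁻¹ := by
  rw [isThreeColorable_iff] at hf ⊢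
  obtain ⟨T, S, h⟩ := hf
  exact ⟨S, T, h.flip.imp fun _ _ h => Matches.symm h⟩

theorem IsThreeColorable.mul {f g : I ≃ₜ I} (hf : IsThreeColorable f)
    (hg : IsThreeColorable g) : IsThreeColorable (f * g) := by
  have hf' := hf.inv
  rw [isThreeColorable_iff] at hg hf' ⊢
  obtain ⟨T, S, h1⟩ := hg
  obtain ⟨U, R, h2⟩ := hf'
  obtain ⟨T', h3⟩ := exists_matches_of_grow h1
    (grow_complete S (max S.height R.height) (le_max_left _ _))
  obtain ⟨U', h4⟩ := exists_matches_of_grow h2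
    (grow_complete R (max S.height R.height) (le_max_right _ _))
  refine ⟨T', U', List.forall₂_iff_get.2 ⟨h3.length_eq.trans h4.length_eq.symm, ?_⟩⟩
  intro i hi hi'
  have hi3 : i < (leaves (completeTree (max S.height R.height))).length := h3.length_eq ▸ hi
  have h5 := (List.forall₂_iff_get.1 h3).2 i hi hi3
  have h6 := ((List.forall₂_iff_get.1 h4).2 i hi' hi3).symm
  rw [inv_inv] at h6
  exact h5.trans h6

/-- The 3-colorable subgroup of `F`. -/
def threeColorable : Subgroup F where
  carrier := {f | IsThreeColorable (f : I ≃ₜ I)}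
  mul_mem' hf hg := IsThreeColorable.mul hf hg
  one_mem' := IsThreeColorable.one
  inv_mem' hf := IsThreeColorable.inv hf

/-! ### The three intermediate subgroups -/

/-- The subgroup generated by the 3-colorable subgroup and `x₀ ^ 2`. -/
noncomputable def M₀ : Subgroup F := Subgroup.closure ((threeColorable : Set F) ∪ {x₀ ^ 2})

/-- The subgroup generated by the 3-colorable subgroup and `x₁ ^ 2`. -/
noncomputable def M₁ : Subgroup F := Subgroup.closure ((threeColorable : Set F) ∪ {x₁ ^ 2})

/-- The subgroup generated by the 3-colorable subgroup and `σ(x₁) ^ 2`. -/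
noncomputable def M₂ : Subgroup F :=
  Subgroup.closure ((threeColorable : Set F) ∪ {sigma x₁ ^ 2})

end Thompson

namespace Thompson

open unitInterval

/-! If $\mathcal F$ had finite index in $\langle\mathcal F, x^2\rangle$, some positive power of
$x^2$ would lie in $\mathcal F$. So it suffices that no $x^{2n}$ with $n\ge 1$ is 3-colorable, for
$x = x_0, x_1, \sigma(x_1)$.

The obstruction is a coloring of the infinite binary tree: the root has colors 0 and 1 on its two
sides, and below each vertex the third color separates its two children. A 3-colorable element that
maps one standard dyadic interval affinely onto another must preserve the color on the left
(`IsThreeColorable.left_color_eq`), even if these intervals are not leaves of the given diagram.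

Each of the three elements shifts along a straight branch below some vertex $p$: with $a$ a
direction and $\bar a$ the opposite one, it sends $paa$ to $pa$ and $pa\bar a$ to $p\bar aa$. Hence
$x^{2n}$ sends $pa^{2n}\bar a$ to $p\bar aa$ (`ShiftsAt.pow_apply`). Going an even number of steps
in one direction restores the pair of colors (`colors_replicate_two_mul`), so the source is colored
like $p\bar a$, for every $n$. A suffix $q$ for which $p\bar aq$ and $p\bar aaq$ have different left
colors then excludes all these powers at once. -/

/-! ### Standard dyadic intervals and their words -/

theorem coe_half (b : Bool) (s : I) : (half b s : ℝ) = ((if b then 1 else 0) + (s : ℝ)) / 2 := rfl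

theorem half_injective (b : Bool) : Function.Injective (half b) := by
  intro s t h
  have h' : (half b s : ℝ) = half b t := congrArg Subtype.val h
  rw [coe_half, coe_half] at h'
  ext
  linarith

theorem cone_injective (w : List Bool) : Function.Injective (cone w) := by
  induction w with
  | nil => exact fun _ _ h => h
  | cons b w ih => exact fun _ _ h => ih (half_injective b h)

/-- The two halves of the interval meet only in the point 1/2, so they cannot share two distinct
points. -/
theorem not_half_half {b b' : Bool} (hb : b ≠ b') {s t s' t' : I} (hst : s ≠ t)
    (hs : half b s = half b' s') (ht : half b t = half b' t') : False := by
  have h1 : (half b s : ℝ) = half b' s' := congrArg Subtype.val hs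
  have h2 : (half b t : ℝ) = half b' t' := congrArg Subtype.val ht
  rw [coe_half, coe_half] at h1 h2
  have := s.2.1
  have := s.2.2
  have := t.2.1
  have := t.2.2
  have := s'.2.1
  have := s'.2.2
  have := t'.2.1
  have := t'.2.2
  apply hst
  ext
  cases b <;> cases b' <;> simp at hb h1 h2 <;> linarith

/-- The left half misses 1 and the right half misses 0, so neither half is the whole interval. -/
theorem not_eq_half (b : Bool) (f : I → I) (h : ∀ s, s = half b (f s)) : False := by
  have h0 : ((0 : I) : ℝ) = half b (f 0) := congrArg Subtype.val (h 0)
  have h1 : ((1 : I) : ℝ) = half b (f 1) := congrArg Subtype.val (h 1)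
  rw [coe_half] at h0 h1
  have := (f 0).2.1
  have := (f 1).2.2
  cases b <;> simp at h0 h1 <;> linarith

/-- A standard dyadic interval determines its word. -/
theorem eq_of_cone_eq {v w : List Bool} (h : ∀ s, cone v s = cone w s) : v = w := by
  induction v generalizing w with
  | nil =>
    cases w with
    | nil => rfl
    | cons b w => exact (not_eq_half b (cone w) h).elim
  | cons b v ih =>
    cases w with
    | nil => exact (not_eq_half b (cone v) fun s => (h s).symm).elim
    | cons b' w =>
      by_cases hb : b = b'
      · subst hb
        rw [ih fun s => half_injective b (h s)]
      -- The words begin differently, but the distinct images of the endpoints 0 and 1 would lie in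
      -- both halves.
      · exact (not_half_half hb ((cone_injective v).ne zero_ne_one) (h 0) (h 1)).elim

/-! ### The color invariant of 3-colorable elements -/

theorem mem_leaves_completeTree (w : List Bool) : w ∈ leaves (completeTree w.length) := by
  induction w with
  | nil => simp [completeTree, leaves]
  | cons b w ih => cases b <;> simpa [completeTree, leaves] using ih

/-- A left child has the same region on its left as its parent. Words can therefore be lengthened by
left steps at no cost to the left color. -/
theorem colors_append_replicate_false (v : List Bool) (k : ℕ) :
    (colors 0 1 (v ++ List.replicate k false)).1 = (colors 0 1 v).1 := by
  rw [colors_append]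
  generalize colors 0 1 v = p
  obtain ⟨x, y⟩ := p
  induction k generalizing y with
  | zero => rfl
  | succ k ih => exact ih (-(x + y))

/-- A 3-colorable element preserves the colors to the left of standard dyadic intervals that it
maps affinely onto each other. -/
theorem IsThreeColorable.left_color_eq {f : I ≃ₜ I} (hf : IsThreeColorable f) {v w : List Bool}
    (h : ∀ s, f (cone v s) = cone w s) : (colors 0 1 v).1 = (colors 0 1 w).1 := by
  obtain ⟨T, S, hTS⟩ := (isThreeColorable_iff f).1 hf
  -- Padding by the height of `S` makes `w ++ u` at least as long as `S` is high, so that `S` grows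
  -- into the complete tree having `w ++ u` as a leaf.
  set u := List.replicate S.height false
  have hlen : S.height ≤ (w ++ u).length := by simp [u]
  obtain ⟨T', hT'⟩ := exists_matches_of_grow hTS (grow_complete S _ hlen)
  obtain ⟨i, hi, hw⟩ := List.getElem_of_mem (mem_leaves_completeTree (w ++ u))
  have hm := (List.forall₂_iff_get.1 hT').2 i (hT'.length_eq ▸ hi) hi
  simp only [List.get_eq_getElem, hw] at hm
  -- The leaf of `T'` paired with `w ++ u` and the word `v ++ u` have the same image under `f`,
  -- pointwise; `f` is injective and an interval determines its word.
  have hv : (leaves T')[i]'(hT'.length_eq ▸ hi) = v ++ u := eq_of_cone_eq fun s => f.injective <| by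
    rw [hm.1, cone_append, cone_append, h]
  have hc := hm.2
  rw [hv, SameColors] at hc
  rw [← colors_append_replicate_false v S.height, ← colors_append_replicate_false w S.height, hc]

/-! ### Even powers of a shift -/

/-- A step in direction `a` keeps the color on that side and replaces the other by `-(x + y)`; a
second such step undoes the replacement. This is where the evenness of the exponent enters. -/
theorem colors_replicate_two_mul (x y : ZMod 3) (a : Bool) (n : ℕ) :
    colors x y (List.replicate (2 * n) a) = (x, y) := by
  induction n with
  | zero => rfl
  | succ n ih =>
    have key : ∀ x y : ZMod 3, -(x + -(x + y)) = y ∧ -(-(x + y) + y) = x := by decide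
    rw [Nat.mul_succ, List.replicate_succ, List.replicate_succ]
    cases a <;> simp only [colors, key] <;> exact ih

/-- An element acting like `x₀` or its inverse below the vertex `p`. -/
def ShiftsAt (f : I ≃ₜ I) (p : List Bool) (a : Bool) : Prop :=
  ∀ s, f (cone (p ++ [a, a]) s) = cone (p ++ [a]) s ∧
    f (cone (p ++ [a, !a]) s) = cone (p ++ [!a, a]) s

/-- Each application of `f` removes one `a` from the run after `p` while at least two are left; the
last application carries `p ++ [a, !a]` across to `p ++ [!a, a]`. -/
theorem ShiftsAt.pow_apply {f : I ≃ₜ I} {p : List Bool} {a : Bool} (h : ShiftsAt f p a) (n : ℕ)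
    (s : I) : (f ^ (n + 1)) (cone (p ++ List.replicate (n + 1) a ++ [!a]) s) =
      cone (p ++ [!a, a]) s := by
  induction n with
  | zero => simpa using (h s).2
  | succ n ih =>
    have h1 := (h (cone (List.replicate n a ++ [!a]) s)).1
    rw [← cone_append, ← cone_append] at h1
    -- The extra factor `f` stands on the right, hence acts first and shortens the run by one.
    rw [pow_succ]
    change (f ^ (n + 1)) (f _) = _
    rw [← ih]
    refine congrArg (f ^ (n + 1)) ?_
    simpa only [List.replicate_succ, List.append_assoc, List.cons_append, List.nil_append] using h1

/-- The suffix `q` is needed because the invariant sees only the left color: for `a = false` the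
words `p ++ [!a]` and `p ++ [!a, a]` always agree in it. -/
theorem ShiftsAt.not_isThreeColorable {f : I ≃ₜ I} {p : List Bool} {a : Bool}
    (h : ShiftsAt f p a) (q : List Bool)
    (hq : (colors 0 1 (p ++ (!a) :: q)).1 ≠ (colors 0 1 (p ++ (!a) :: a :: q)).1) (n : ℕ)
    (hn : n ≠ 0) : ¬ IsThreeColorable (f ^ (2 * n)) := by
  intro hf
  obtain ⟨m, hm⟩ : ∃ m, 2 * n = m + 1 := ⟨2 * n - 1, by omega⟩
  apply hq
  have := hf.left_color_eq (v := p ++ List.replicate (2 * n) a ++ [!a] ++ q)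
    (w := p ++ [!a, a] ++ q) fun s => by
      rw [cone_append _ q, cone_append _ q, hm]
      exact h.pow_apply m _
  -- The run of `2 * n` letters drops out of the source color, which leaves the two words compared
  -- in `hq`.
  simpa [colors_append, colors_replicate_two_mul] using this

/-! ### Infinite index, and the three elements -/

/-- By pigeonhole on the cosets of the powers of `x`, a subgroup of finite index, normal or not,
contains a positive power of `x`. -/
theorem infinite_quotient_of_pow_notMem {G : Type*} [Group G] (H : Subgroup G) (x : G)
    (hx : ∀ n ≠ 0, x ^ n ∉ H) :
    Infinite (Subgroup.closure ((H : Set G) ∪ {x}) ⧸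
      H.subgroupOf (Subgroup.closure ((H : Set G) ∪ {x}))) := by
  by_contra hfin
  rw [not_infinite_iff_finite, ← Subgroup.finiteIndex_iff_finite_quotient] at hfin
  obtain ⟨n, hn, -, h⟩ := Subgroup.exists_pow_mem_of_index_ne_zero hfin.index_ne_zero
    ⟨x, Subgroup.subset_closure (Or.inr rfl)⟩
  exact hx n hn.ne' h

theorem infinite_quotient_of_shiftsAt (x : F) {p : List Bool} {a : Bool}
    (h : ShiftsAt x p a) (q : List Bool)
    (hq : (colors 0 1 (p ++ (!a) :: q)).1 ≠ (colors 0 1 (p ++ (!a) :: a :: q)).1) :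
    Infinite (Subgroup.closure ((threeColorable : Set F) ∪ {x ^ 2}) ⧸
      threeColorable.subgroupOf (Subgroup.closure ((threeColorable : Set F) ∪ {x ^ 2}))) := by
  refine infinite_quotient_of_pow_notMem _ _ fun n hn hmem => ?_
  rw [← pow_mul] at hmem
  exact h.not_isThreeColorable q hq n hn hmem

/-- The slope 2 piece takes $[0,\frac14]$ to $[0,\frac12]$, and the translation takes
$[\frac14,\frac12]$ to $[\frac12,\frac34]$. -/
theorem shiftsAt_x₀ : ShiftsAt x₀ [] false := by
  intro s
  have := s.2.1
  have := s.2.2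
  constructor <;> ext <;>
    simp only [x₀, x₀Homeo_apply, List.nil_append, Bool.not_false, cone, coe_half] <;> grind

theorem shiftsAt_x₁ : ShiftsAt x₁ [true] false := by
  intro s
  have := s.2.1
  have := s.2.2
  constructor <;> ext <;>
    simp only [x₁, x₁Homeo_apply, List.cons_append, List.nil_append, Bool.not_false, cone,
      coe_half] <;> grind

/-- This is the mirror image of the shift of `x₁` below `[true]`: reflection exchanges left and
right in every word. -/
theorem shiftsAt_sigma_x₁ : ShiftsAt (sigma x₁) [false] true := by
  intro s
  have := s.2.1
  have := s.2.2
  constructor <;> ext <;> change ((σ (x₁Homeo (σ _)) : I) : ℝ) = _ <;>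
    simp only [coe_symm_eq, x₁Homeo_apply, List.cons_append, List.nil_append, Bool.not_true, cone,
      coe_half] <;> grind

end Thompson

theorem mainTheorem7 :
    Infinite (Thompson.M₀ ⧸ Thompson.threeColorable.subgroupOf Thompson.M₀) ∧
    Infinite (Thompson.M₁ ⧸ Thompson.threeColorable.subgroupOf Thompson.M₁) ∧
    Infinite (Thompson.M₂ ⧸ Thompson.threeColorable.subgroupOf Thompson.M₂) :=
  -- For `a = false` a final right step makes the discrepancy on the right visible on the left. For
  -- `sigma x₁`, where `a = true`, the left colors of the words 00 and 001 are already 0 and 2, so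
  -- the empty suffix suffices.
  ⟨Thompson.infinite_quotient_of_shiftsAt _ Thompson.shiftsAt_x₀ [true] (by decide),
    Thompson.infinite_quotient_of_shiftsAt _ Thompson.shiftsAt_x₁ [true] (by decide),
    Thompson.infinite_quotient_of_shiftsAt _ Thompson.shiftsAt_sigma_x₁ [] (by decide)⟩
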